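/- Let $k$ be a commutative Noetherian ring with identity, and let $C$ be a $k$-linear category whose objects are the nonnegative integers, which is locally finite (each $C(r,s)$ is a finitely generated $k$-module) and directed ($C(r,s)=0$ whenever $r>s$). A $C$-module is a covariant $k$-linear functor $V$ from $C$ to the category of $k$-modules; write $V_s=V(s)$, and write $M(s)=C(s,-)$ for the representable $C$-modules. Here $V$ is finitely generated if it contains a finite set that lies in no proper $C$-submodule of $V$; it is Noetherian if all its submodules are finitely generated; it is finitely presented if there is an exact sequence $P_1\to P_0\to V\to 0$ with $P_0,P_1$ finitely generated projective $C$-modules; and it is generated in degrees $\leqslant d$ if the only submodule containing all $V_r$ with $r\leqslant d$ is $V$ (so, for $d=-1$, if $V=0$). A shift functor $S$ is an endofunctor of the category of $C$-modules of the form $V\mapsto V\circ\iota$, where $\iota:C\to C$ is a faithful $k$-linear functor with $\iota(s)=s+1$ for all $s\geqslant 0$. It is generic if there is a natural transformation $\mu:\mathrm{Id}\to S$ such that, for every $s\geqslant 0$, the map $\mu_{M(s)}:M(s)\to SM(s)$ is injective and its cokernel is generated in degrees $\leqslant s-1$. Suppose that $S$ is a generic shift functor. Then every finitely generated $C$-module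 is Noetherian if and only if $SM(s)$ is finitely presented for every $s\geqslant 0$. -/

import Mathlib

open CategoryTheory

universe u v w

namespace LinCat

section

variable (k : Type u) [CommRing k] (C : Type w) [Category.{v} C] [Preadditive C] [Linear k C]

/-- The property of a functor from a `k`-linear category to `k`-modules of being `k`-linear. -/
def isLinear : ObjectProperty (C ⥤ ModuleCat.{v} k) :=
  fun F => F.Additive ∧ F.Linear k

/-- The category of `C`-modules: `k`-linear functors from `C` to the category of `k`-modules, with
all natural transformations as morphisms. -/
abbrev Mod := (isLinear k C).FullSubcategory

variable {C}

/-- The representable `C`-module `C(X, -)`. -/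
def representable (X : C) : Mod k C :=
  ⟨(linearCoyoneda k C).obj (Opposite.op X),
    inferInstance,
    ⟨fun f r => by
      ext g
      exact Linear.comp_smul (R := k) _ _ _ g r f⟩⟩

/-- The pull-back functor on `C`-modules induced by a `k`-linear functor from `C` to itself. -/
def pullback (ι : C ⥤ C) [ι.Additive] [ι.Linear k] : Mod k C ⥤ Mod k C where
  obj V := ⟨ι ⋙ V.obj, by
    have := V.property.1
    have := V.property.2
    exact ⟨inferInstance, inferInstance⟩⟩
  map f := ObjectProperty.homMk (Functor.whiskerLeft ι f.hom)

end

section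

variable {k : Type u} [CommRing k] {C : Type w} [Category.{v} C] [Preadditive C] [Linear k C]

/-- The component at the object `X` of a homomorphism of `C`-modules, as a linear map. -/
def component {V W : Mod k C} (f : V ⟶ W) (X : C) : V.obj.obj X →ₗ[k] W.obj.obj X :=
  (f.hom.app X).hom

/-- A `C`-submodule of `V`: a family of `k`-submodules stable under the action of `C`. -/
@[ext]
structure Sub (V : Mod k C) where
  carrier : ∀ X : C, Submodule k (V.obj.obj X)
  map_mem : ∀ {X Y : C} (f : X ⟶ Y) {x : V.obj.obj X},
    x ∈ carrier X → (V.obj.map f).hom x ∈ carrier Y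

namespace Sub

/-- `N` is a finitely generated submodule: it contains a finite set `T` of (homogeneous) elements
such that every submodule containing `T` contains `N`. -/
def FG {V : Mod k C} (N : Sub V) : Prop :=
  ∃ T : Set (Σ X : C, V.obj.obj X), T.Finite ∧ (∀ t ∈ T, t.2 ∈ N.carrier t.1) ∧
    ∀ N' : Sub V, (∀ t ∈ T, t.2 ∈ N'.carrier t.1) → ∀ X, N.carrier X ≤ N'.carrier X

/-- The quotient `C`-module `V / N`. -/
def quotient {V : Mod k C} (N : Sub V) : Mod k C :=
  ⟨{ obj := fun X => ModuleCat.of k (V.obj.obj X ⧸ N.carrier X)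
     map := fun {X Y} f => ModuleCat.ofHom
       (Submodule.mapQ (N.carrier X) (N.carrier Y) (V.obj.map f).hom fun _ hx => N.map_mem f hx)
     map_id := fun X => by
       ext x
       simp
     map_comp := fun {X Y Z} f g => by
       ext x
       simp },
    ⟨fun {X Y f g} => by
      have := V.property.1
      ext x
      simp [V.obj.map_add]⟩,
    ⟨fun {X Y} f r => by
      have := V.property.2
      ext x
      simp [V.obj.map_smul]⟩⟩

end Sub

/-- The image of a homomorphism of `C`-modules. -/
def image {V W : Mod k C} (f : V ⟶ W) : Sub W where
  carrier X := LinearMap.range (component f X)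
  map_mem := by
    rintro X Y g _ ⟨x, rfl⟩
    exact ⟨(V.obj.map g).hom x, ConcreteCategory.congr_hom (f.hom.naturality g) x⟩

/-- The cokernel of a homomorphism of `C`-modules. -/
def coker {V W : Mod k C} (f : V ⟶ W) : Mod k C :=
  (image f).quotient

/-- `V` is finitely generated: it contains a finite set such that the only submodule of `V`
containing this set is `V` itself. -/
def IsFinitelyGenerated (V : Mod k C) : Prop :=
  ∃ T : Set (Σ X : C, V.obj.obj X), T.Finite ∧
    ∀ N : Sub V, (∀ t ∈ T, t.2 ∈ N.carrier t.1) → ∀ X, N.carrier X = ⊤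

/-- `V` is Noetherian: all its submodules are finitely generated. -/
def IsNoeth (V : Mod k C) : Prop :=
  ∀ N : Sub V, N.FG

/-- `V` is finitely presented: there is an exact sequence `P₁ ⟶ P₀ ⟶ V ⟶ 0` with `P₁` and `P₀`
finitely generated and projective. -/
def IsFinitelyPresented (V : Mod k C) : Prop :=
  ∃ (P₁ P₀ : Mod k C) (d : P₁ ⟶ P₀) (ε : P₀ ⟶ V),
    Projective P₁ ∧ Projective P₀ ∧ IsFinitelyGenerated P₁ ∧ IsFinitelyGenerated P₀ ∧
    (∀ X, Function.Surjective (component ε X)) ∧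
    ∀ X, Function.Exact (component d X) (component ε X)

/-- `V` is generated in degrees `≤ d`, where the object `obj r` has degree `r`. For `d = -1` this
says that `V = 0`. -/
def IsGeneratedInDegreesLE (obj : ℕ ≃ C) (V : Mod k C) (d : ℤ) : Prop :=
  ∀ N : Sub V, (∀ r : ℕ, (r : ℤ) ≤ d → N.carrier (obj r) = ⊤) → ∀ X, N.carrier X = ⊤

/-- A functor `S` on `C`-modules is a shift functor if it is the pull-back functor induced by a
faithful (`k`-linear) functor from `C` to itself that sends each object `s` to `s + 1`. -/
def IsShiftFunctor (obj : ℕ ≃ C) (S : Mod k C ⥤ Mod k C) : Prop :=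
  ∃ (ι : C ⥤ C) (_ : ι.Additive) (_ : ι.Linear k),
    ι.Faithful ∧ (∀ s : ℕ, ι.obj (obj s) = obj (s + 1)) ∧ S = pullback k ι

/-- A shift functor `S` is generic if there is a natural transformation `μ : Id ⟶ S` such that, for
every `s`, the map `μ` on `M(s)` is injective with cokernel generated in degrees `≤ s - 1`. -/
def IsGenericShiftFunctor (obj : ℕ ≃ C) (S : Mod k C ⥤ Mod k C) : Prop :=
  IsShiftFunctor obj S ∧ ∃ μ : 𝟭 (Mod k C) ⟶ S, ∀ s : ℕ,
    (∀ X, Function.Injective (component (μ.app (representable k (obj s))) X)) ∧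
    IsGeneratedInDegreesLE obj (coker (μ.app (representable k (obj s)))) ((s : ℤ) - 1)

end

end LinCat

/-! Genericity makes every M(s) Noetherian, so both sides of the equivalence hold. The proof is by
strong induction on s. The cokernel of M(s) → SM(s) is generated in degrees below s and is locally
finite, so it is a quotient of a finite sum of modules M(r) with r < s, hence Noetherian.

It remains to pass from the cokernel of V → SV to V (`wellFoundedGT_of_coker_natTrans`), in the
manner of Hilbert's basis theorem. For a submodule N let TN consist of the x with μ(x) in N, so that
N ≤ TN. In degree r + 1, a submodule N is SN in degree r, and so, among comparable submodules, it is
determined by its image in the cokernel and by TN in degree r. For an ascending chain (N_i), the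
images of S(T^a N_i) in the cokernel stabilize uniformly in a. Induction on the degree then
stabilizes all T^a N_i at once, and a = 0 is the claim.

Once all M(s) are Noetherian, so are all finitely generated modules. Each SM(s) is an extension of
Noetherian modules, hence Noetherian and finitely presented. -/

/-! ### Chain conditions in ordered sets and modular lattices -/

/-- The diagonal stabilizes at some n₀, and by monotonicity F is constant on the quadrant i, a ≥ n₀.
Only finitely many a < n₀ remain, and each of these sequences stabilizes separately. -/
theorem exists_uniform_stabilization {α : Type*} [PartialOrder α] [WellFoundedGT α]
    (F : ℕ → ℕ → α) (hF : ∀ ⦃i j⦄, i ≤ j → ∀ ⦃a b⦄, a ≤ b → F i a ≤ F j b) :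
    ∃ n, ∀ a i, n ≤ i → F n a = F i a := by
  obtain ⟨n₀, hn₀⟩ := WellFoundedGT.monotone_chain_condition
    (⟨fun n => F n n, fun i j h => hF h h⟩ : ℕ →o α)
  have h₁ : ∀ a, ∃ n, ∀ i, n ≤ i → F n a = F i a := fun a =>
    WellFoundedGT.monotone_chain_condition
      (⟨fun n => F n a, fun i j h => hF h le_rfl⟩ : ℕ →o α)
  choose f hf using h₁
  refine ⟨max n₀ ((Finset.range n₀).sup f), fun a i hi => ?_⟩
  obtain ha | ha := lt_or_ge a n₀
  · have : f a ≤ (Finset.range n₀).sup f := Finset.le_sup (Finset.mem_range.2 ha)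
    rw [← hf a i (by omega), ← hf a _ (this.trans (le_max_right _ _))]
  · have key : ∀ i, n₀ ≤ i → F i a = F n₀ n₀ := fun i hi => by
      refine le_antisymm ?_ (hF hi ha)
      rw [show F n₀ n₀ = F (max i a) (max i a) from hn₀ _ (hi.trans (le_max_left _ _))]
      exact hF (le_max_left _ _) (le_max_right _ _)
    rw [key i (by omega), key _ (le_max_left _ _)]

/-- Chains involve only comparable elements, so invariants need to separate only those; this is what
modularity provides. -/
theorem Monotone.wellFoundedGT_of_injective_on_le {α β : Type*} [PartialOrder α] [PartialOrder β]
    [WellFoundedGT β] {f : α → β} (hf : Monotone f)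
    (h : ∀ ⦃x y⦄, x ≤ y → f x = f y → x = y) : WellFoundedGT α :=
  StrictMono.wellFoundedGT (f := f) fun _ _ hxy =>
    (hf hxy.le).lt_of_ne fun he => hxy.ne (h hxy.le he)

/-- By the modular law, x ⊓ a and (x ⊔ a) ⊓ b separate comparable elements below a ⊔ b: the second
recovers x ⊔ a, because a ⊔ ((x ⊔ a) ⊓ b) = x ⊔ a. -/
theorem wellFoundedGT_Iic_sup {α : Type*} [Lattice α] [IsModularLattice α] {a b : α}
    (ha : WellFoundedGT (Set.Iic a)) (hb : WellFoundedGT (Set.Iic b)) :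
    WellFoundedGT (Set.Iic (a ⊔ b)) := by
  let φ : Set.Iic (a ⊔ b) → Set.Iic a × Set.Iic b := fun x =>
    (⟨x.1 ⊓ a, inf_le_right⟩, ⟨(x.1 ⊔ a) ⊓ b, inf_le_right⟩)
  have hφ : Monotone φ := fun x y h =>
    ⟨inf_le_inf_right a h, inf_le_inf_right b (sup_le_sup_right (show x.1 ≤ y.1 from h) a)⟩
  have hsup : ∀ x : Set.Iic (a ⊔ b), a ⊔ (x.1 ⊔ a) ⊓ b = x.1 ⊔ a := fun x => by
    rw [inf_comm, ← sup_inf_assoc_of_le b (le_sup_right : a ≤ x.1 ⊔ a)]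
    exact inf_eq_right.2 (sup_le x.2 le_sup_left)
  refine hφ.wellFoundedGT_of_injective_on_le fun x y h he => Subtype.ext ?_
  have h₁ : x.1 ⊓ a = y.1 ⊓ a := congr_arg (fun z => z.1.1) he
  have h₂ : (x.1 ⊔ a) ⊓ b = (y.1 ⊔ a) ⊓ b := congr_arg (fun z => z.2.1) he
  exact eq_of_le_of_inf_le_of_sup_le (z := a) h h₁.ge (by rw [← hsup x, ← hsup y, h₂])

theorem wellFoundedGT_Iic_finsetSup {α β : Type*} [Lattice α] [OrderBot α] [IsModularLattice α]
    (s : Finset β) (f : β → α) (h : ∀ b ∈ s, WellFoundedGT (Set.Iic (f b))) :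
    WellFoundedGT (Set.Iic (s.sup f)) := by
  classical
  induction s using Finset.induction_on with
  | empty =>
    rw [Finset.sup_empty]
    have : Subsingleton (Set.Iic (⊥ : α)) :=
      ⟨fun x y => Subtype.ext ((le_bot_iff.1 x.2).trans (le_bot_iff.1 y.2).symm)⟩
    exact Finite.to_wellFoundedGT
  | insert b s _ ih =>
    rw [Finset.sup_insert]
    exact wellFoundedGT_Iic_sup (h b (by simp)) (ih fun c hc => h c (by simp [hc]))

/-! ### The lattice of submodules of a `C`-module -/

namespace LinCat

variable {k : Type u} [CommRing k] {C : Type w} [Category.{v} C] [Preadditive C] [Linear k C]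

theorem component_map {V W : Mod k C} (f : V ⟶ W) {X Y : C} (g : X ⟶ Y) (x : V.obj.obj X) :
    component f Y ((V.obj.map g).hom x) = (W.obj.map g).hom (component f X x) :=
  ConcreteCategory.congr_hom (f.hom.naturality g) x

theorem component_comp {U V W : Mod k C} (f : U ⟶ V) (g : V ⟶ W) (X : C) (x : U.obj.obj X) :
    component (f ≫ g) X x = component g X (component f X x) := rfl

theorem hom_ext {V W : Mod k C} {f g : V ⟶ W}
    (h : ∀ X x, component f X x = component g X x) : f = g := by
  apply ObjectProperty.hom_ext
  ext X x
  exact h X x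

namespace Sub

variable {V W : Mod k C}

instance : PartialOrder (Sub V) := PartialOrder.lift carrier fun _ _ => Sub.ext

theorem carrier_injective : Function.Injective (carrier (V := V)) := fun _ _ => Sub.ext

instance : Min (Sub V) := ⟨fun N N' => ⟨fun X => N.carrier X ⊓ N'.carrier X,
  fun f _ hx => ⟨N.map_mem f hx.1, N'.map_mem f hx.2⟩⟩⟩

instance : InfSet (Sub V) := ⟨fun s => ⟨fun X => ⨅ N ∈ s, N.carrier X, fun f x hx => by
  simp only [Submodule.mem_iInf] at hx ⊢
  exact fun N hN => N.map_mem f (hx N hN)⟩⟩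

instance : Max (Sub V) := ⟨fun N N' => ⟨fun X => N.carrier X ⊔ N'.carrier X,
  fun {X Y} f x hx => by
    have h : N.carrier X ⊔ N'.carrier X ≤
        (N.carrier Y ⊔ N'.carrier Y).comap (V.obj.map f).hom :=
      sup_le (fun y hy => Submodule.mem_sup_left (N.map_mem f hy))
        (fun y hy => Submodule.mem_sup_right (N'.map_mem f hy))
    exact h hx⟩⟩

instance : SupSet (Sub V) := ⟨fun s => ⟨fun X => ⨆ N ∈ s, N.carrier X, fun {X Y} f x hx => by
  have h : ⨆ N ∈ s, N.carrier X ≤ (⨆ N ∈ s, N.carrier Y).comap (V.obj.map f).hom :=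
    iSup₂_le fun N hN y hy => Submodule.mem_iSup_of_mem N (Submodule.mem_iSup_of_mem hN
      (N.map_mem f hy))
  exact h hx⟩⟩

instance : Top (Sub V) := ⟨⟨fun _ => ⊤, fun _ _ _ => trivial⟩⟩

instance : Bot (Sub V) := ⟨⟨fun _ => ⊥, fun f x hx => by
  rw [Submodule.mem_bot] at hx ⊢
  rw [hx, map_zero]⟩⟩

instance : CompleteLattice (Sub V) := carrier_injective.completeLattice _ Iff.rfl Iff.rfl
  (fun _ _ => rfl) (fun _ _ => rfl)
  (fun s => by ext1 X; simp [sSup, iSup_apply]) (fun s => by ext1 X; simp [sInf, iInf_apply]) rfl rfl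

instance : IsModularLattice (Sub V) :=
  ⟨fun {_} y {_} h X => IsModularLattice.sup_inf_le_assoc_of_le (y.carrier X) (h X)⟩

/-- The preimage of a submodule under a homomorphism. -/
def comap (f : V ⟶ W) (N : Sub W) : Sub V where
  carrier X := (N.carrier X).comap (component f X)
  map_mem g x hx := by
    rw [Submodule.mem_comap, component_map]
    exact N.map_mem g hx

theorem comap_mono (f : V ⟶ W) : Monotone (comap f) := fun _ _ h X =>
  Submodule.comap_mono (h X)

/-- The image of a submodule under a homomorphism. -/
def map (f : V ⟶ W) (N : Sub V) : Sub W where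
  carrier X := (N.carrier X).map (component f X)
  map_mem := by
    rintro X Y g _ ⟨x, hx, rfl⟩
    exact ⟨(V.obj.map g).hom x, N.map_mem g hx, component_map f g x⟩

theorem map_mono (f : V ⟶ W) : Monotone (map f) := fun _ _ h X =>
  Submodule.map_mono (h X)

/-- The projection of a module onto its quotient by a submodule. -/
def proj (N : Sub V) : V ⟶ N.quotient :=
  ObjectProperty.homMk
    { app := fun X => ModuleCat.ofHom (N.carrier X).mkQ
      naturality := fun _ _ _ => rfl }

/-- This is the modular law in one degree. Fixing `X` matters: in the induction on degrees, the
intersections are controlled only in the degree at hand. -/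
theorem eq_of_map_proj_eq {N P Q : Sub V} {X : C} (h : P ≤ Q)
    (hmap : (map N.proj P).carrier X = (map N.proj Q).carrier X)
    (hinf : Q.carrier X ⊓ N.carrier X ≤ P.carrier X) : P.carrier X = Q.carrier X := by
  refine eq_of_le_of_inf_le_of_le_sup (z := N.carrier X) (h X) hinf ?_
  have h₁ := congr_arg (Submodule.comap (N.carrier X).mkQ) hmap
  have h₂ : ∀ R : Sub V, Submodule.comap (N.carrier X).mkQ ((map N.proj R).carrier X) =
      N.carrier X ⊔ R.carrier X := fun R => Submodule.comap_map_mkQ _ _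
  rw [h₂, h₂] at h₁
  rw [sup_comm, h₁]
  exact le_sup_right

end Sub

/-- The homomorphism from a representable module that corresponds to an element. -/
def ofElem {V : Mod k C} {X : C} (x : V.obj.obj X) : representable k X ⟶ V :=
  ObjectProperty.homMk
    { app := fun Y => ModuleCat.ofHom
        { toFun := fun g : X ⟶ Y => (V.obj.map g).hom x
          map_add' := fun f g => by
            have := V.property.1
            simp [V.obj.map_add]
          map_smul' := fun r g => by
            have := V.property.2
            simp [V.obj.map_smul] }
      naturality := fun Y Z f => by
        ext (g : X ⟶ Y)
        change (V.obj.map (g ≫ f)).hom x = (V.obj.map f).hom ((V.obj.map g).hom x)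
        simp }

theorem component_ofElem {V : Mod k C} {X : C} (x : V.obj.obj X) {Y : C} (g : X ⟶ Y) :
    component (ofElem x) Y g = (V.obj.map g).hom x := rfl

theorem mem_image_ofElem {V : Mod k C} {X : C} (x : V.obj.obj X) :
    x ∈ (image (ofElem x)).carrier X :=
  ⟨𝟙 X, by rw [component_ofElem, V.obj.map_id]; rfl⟩

theorem image_ofElem_le_iff {V : Mod k C} {X : C} {x : V.obj.obj X} {N : Sub V} :
    image (ofElem x) ≤ N ↔ x ∈ N.carrier X := by
  refine ⟨fun h => h X (mem_image_ofElem x), fun h Y => ?_⟩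
  rintro _ ⟨g, rfl⟩
  exact N.map_mem g h

namespace Sub

variable {V W : Mod k C}

/-- A submodule is the supremum of its cyclic submodules, and under the ascending chain condition
finitely many of them already attain this supremum. -/
theorem FG_of_wellFoundedGT [WellFoundedGT (Sub V)] (N : Sub V) : N.FG := by
  let f : {t : Σ X : C, V.obj.obj X // t.2 ∈ N.carrier t.1} → Sub V := fun t =>
    image (ofElem t.1.2)
  have hf : sSup (Set.range f) = N := by
    refine le_antisymm (sSup_le ?_) fun X x hx => ?_
    · rintro _ ⟨t, rfl⟩
      exact image_ofElem_le_iff.2 t.2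
    · exact le_sSup (Set.mem_range_self (f := f) ⟨⟨X, x⟩, hx⟩) X (mem_image_ofElem x)
  classical
  obtain ⟨s, hs, hsup⟩ :=
    CompleteLattice.WellFoundedGT.isSupFiniteCompact (Sub V) (Set.range f)
  rw [← Set.image_univ, Finset.subset_set_image_iff] at hs
  obtain ⟨T, -, rfl⟩ := hs
  refine ⟨Subtype.val '' (T : Set {t : Σ X : C, V.obj.obj X // t.2 ∈ N.carrier t.1}), T.finite_toSet.image _, ?_, fun N' hN' => ?_⟩
  · rintro _ ⟨t, -, rfl⟩
    exact t.2
  · rw [← hf, hsup]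
    change _ ≤ N'
    rw [Finset.sup_image, Finset.sup_le_iff]
    exact fun t ht => image_ofElem_le_iff.2 (hN' _ ⟨t, ht, rfl⟩)

theorem wellFoundedGT_Iic_image (f : V ⟶ W) [WellFoundedGT (Sub V)] :
    WellFoundedGT (Set.Iic (image f)) := by
  refine Monotone.wellFoundedGT_of_injective_on_le (f := fun N : Set.Iic (image f) => comap f N.1)
    (fun N N' h => comap_mono f h) fun N N' h he => h.antisymm fun X x hx => ?_
  obtain ⟨y, rfl⟩ := N'.2 X hx
  have : y ∈ (comap f N'.1).carrier X := hx
  rwa [← he] at this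

/-- Comparable submodules of `W` with the same preimage in `V` and the same image in the cokernel
coincide. -/
theorem wellFoundedGT_of_image_of_coker (f : V ⟶ W) [WellFoundedGT (Sub V)]
    [WellFoundedGT (Sub (coker f))] : WellFoundedGT (Sub W) := by
  refine Monotone.wellFoundedGT_of_injective_on_le
    (f := fun N : Sub W => (comap f N, (map (image f).proj N : Sub (coker f))))
    (fun N N' h => Prod.mk_le_mk.2 ⟨comap_mono f h, map_mono _ h⟩) fun N N' h he => ?_
  obtain ⟨h₁, h₂⟩ := Prod.ext_iff.1 he
  dsimp only at h₁ h₂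
  ext1
  funext X
  refine eq_of_map_proj_eq (N := image f) h
    (congr_arg (fun P => P.carrier X) h₂) ?_
  rintro _ ⟨hx, y, rfl⟩
  have : y ∈ (comap f N').carrier X := hx
  rwa [← h₁] at this

theorem wellFoundedGT_of_iSup_image {ι : Type*} (s : Finset ι) (f : ι → Σ X : C, V.obj.obj X)
    (hf : ∀ i ∈ s, WellFoundedGT (Sub (representable k (f i).1)))
    (h : ∀ N : Sub V, (∀ i ∈ s, (f i).2 ∈ N.carrier (f i).1) → ∀ X, N.carrier X = ⊤) :
    WellFoundedGT (Sub V) := by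
  have h₁ : (s.sup fun i => image (ofElem (f i).2)) = ⊤ := by
    ext1
    funext X
    exact h _ (fun i hi => image_ofElem_le_iff.1
      (Finset.le_sup (f := fun i => image (ofElem (f i).2)) hi)) X
  have h₂ := wellFoundedGT_Iic_finsetSup s (fun i => image (ofElem (f i).2)) fun i hi =>
    have := hf i hi
    wellFoundedGT_Iic_image _
  rw [h₁] at h₂
  exact StrictMono.wellFoundedGT (f := fun N : Sub V => (⟨N, Set.mem_Iic.2 le_top⟩ : Set.Iic (⊤ : Sub V)))
    fun _ _ h => h

end Sub
-- Shifts and the stabilization argument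
section shift

variable {ι : C ⥤ C} [ι.Additive] [ι.Linear k]

/-- A natural transformation from the identity to a pull-back functor acts by morphisms of `C`. -/
theorem component_natTrans_app (μ : 𝟭 (Mod k C) ⟶ pullback k ι) (V : Mod k C) {X : C}
    (x : V.obj.obj X) :
    component (μ.app V) X x =
      (V.obj.map (show X ⟶ ι.obj X from
        component (μ.app (representable k X)) X (𝟙 X))).hom x := by
  -- Yoneda: naturality along the map M(X) → V sending the identity to `x` reduces the claim to the
  -- universal element.
  have h := congr_arg (fun f => component f X (𝟙 X)) (μ.naturality (ofElem x))
  have h' : component (ofElem x) X (𝟙 X) = x := by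
    rw [component_ofElem, V.obj.map_id]
    rfl
  calc component (μ.app V) X x = component (μ.app V) X (component (ofElem x) X (𝟙 X)) := by rw [h']
    _ = _ := h

namespace Sub

variable {V : Mod k C}

variable (ι) in
/-- The submodule of the pull-back of `V` defined by a submodule of `V`. -/
def shift (N : Sub V) : Sub ((pullback k ι).obj V) where
  carrier X := N.carrier (ι.obj X)
  map_mem f _ hx := N.map_mem (ι.map f) hx

theorem shift_mono : Monotone (shift (k := k) (V := V) ι) := fun _ _ h X => h (ι.obj X)

theorem le_comap_shift (μ : 𝟭 (Mod k C) ⟶ pullback k ι) (N : Sub V) :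
    N ≤ comap (μ.app V) (shift ι N) := fun X x hx => by
  change component (μ.app V) X x ∈ N.carrier (ι.obj X)
  rw [component_natTrans_app]
  exact N.map_mem _ hx

/-- If the cokernel of `V ⟶ S V` is Noetherian then so is `V`. -/
theorem wellFoundedGT_of_coker_natTrans (obj : ℕ ≃ C)
    (hι : ∀ s : ℕ, ι.obj (obj s) = obj (s + 1)) (μ : 𝟭 (Mod k C) ⟶ pullback k ι)
    [IsNoetherian k (V.obj.obj (obj 0))] [WellFoundedGT (Sub (coker (μ.app V)))] :
    WellFoundedGT (Sub V) := by
  let T : Sub V → Sub V := fun N => comap (μ.app V) (shift ι N)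
  have hT : Monotone T := fun N N' h => comap_mono _ (shift_mono h)
  rw [wellFoundedGT_iff_monotone_chain_condition]
  intro N
  -- The iterates of `T` are carried along because controlling `N i` in degree r + 1 requires `T (N
  -- i)` in degree r.
  let F : ℕ → ℕ → Sub V := fun i a => T^[a] (N i)
  have hF : ∀ ⦃i j⦄, i ≤ j → ∀ ⦃a b⦄, a ≤ b → F i a ≤ F j b := fun i j hij a b hab =>
    ((hT.iterate a) (N.monotone hij)).trans
      (Function.monotone_iterate_of_id_le (f := T) (le_comap_shift μ) hab (N j))
  obtain ⟨n₁, hn₁⟩ := exists_uniform_stabilization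
    (fun i a => (F i a).carrier (obj 0)) fun i j hij a b hab => hF hij hab (obj 0)
  obtain ⟨n₂, hn₂⟩ := exists_uniform_stabilization
    (fun i a => (map (image (μ.app V)).proj (shift ι (F i a)) : Sub (coker (μ.app V))))
    fun i j hij a b hab => map_mono _ (shift_mono (hF hij hab))
  -- The bound is independent of both `r` and `a`; the step from r to r + 1 uses the hypothesis at a
  -- + 1.
  have key : ∀ r a i, max n₁ n₂ ≤ i →
      (F (max n₁ n₂) a).carrier (obj r) = (F i a).carrier (obj r) := by
    intro r
    induction r with
    | zero =>
      intro a i hi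
      exact (hn₁ a _ (le_max_left _ _)).symm.trans (hn₁ a i ((le_max_left _ _).trans hi))
    | succ r ih =>
      intro a i hi
      rw [← hι r]
      refine eq_of_map_proj_eq (N := image (μ.app V)) (P := shift ι (F (max n₁ n₂) a))
        (Q := shift ι (F i a)) (X := obj r) (shift_mono (hF hi le_rfl)) ?_ ?_
      · have := (hn₂ a (max n₁ n₂) (le_max_right _ _)).symm.trans
          (hn₂ a i ((le_max_right _ _).trans hi))
        exact congr_arg (fun N => N.carrier (obj r)) this
      -- An element μ(x) lies in the shift of `F i a` exactly when x lies in `T (F i a) = F i (a +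
      -- 1)`, which is known in degree r.
      · have hS : ∀ j, F j (a + 1) = T (F j a) := fun j => Function.iterate_succ_apply' T a (N j)
        rintro _ ⟨hx, x, rfl⟩
        have h₁ : x ∈ (F i (a + 1)).carrier (obj r) := by
          rw [hS]
          exact hx
        rw [← ih (a + 1) i hi, hS] at h₁
        exact h₁
  refine ⟨max n₁ n₂, fun m hm => ?_⟩
  ext1
  funext X
  obtain ⟨r, rfl⟩ := obj.surjective X
  exact key r 0 m hm

end Sub
end shift

/-! ### Noetherianity from generators -/

theorem wellFoundedGT_of_isGeneratedInDegreesLE (obj : ℕ ≃ C) {V : Mod k C} {d : ℤ}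
    (hV : IsGeneratedInDegreesLE obj V d) (hfin : ∀ r, Module.Finite k (V.obj.obj (obj r)))
    (h : ∀ r : ℕ, (r : ℤ) ≤ d → WellFoundedGT (Sub (representable k (obj r)))) :
    WellFoundedGT (Sub V) := by
  choose s hs using fun r => (hfin r).fg_top
  -- For d = -1 the range is empty: no generators are needed, as V = 0.
  let D := (Finset.range (d + 1).toNat).sigma s
  refine Sub.wellFoundedGT_of_iSup_image D
    (fun i : Σ r, V.obj.obj (obj r) => ⟨obj i.1, i.2⟩) (fun i hi => ?_) fun N hN => hV N ?_
  · have := Finset.mem_range.1 (Finset.mem_sigma.1 hi).1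
    exact h _ (by omega)
  · intro r hr
    have hr' : r < (d + 1).toNat := by omega
    rw [← top_le_iff, ← hs r, Submodule.span_le]
    exact fun x hx => hN ⟨r, x⟩ (Finset.mem_sigma.2 ⟨Finset.mem_range.2 hr', hx⟩)

theorem IsFinitelyGenerated.wellFoundedGT {V : Mod k C} (hV : IsFinitelyGenerated V)
    (h : ∀ X : C, WellFoundedGT (Sub (representable k X))) : WellFoundedGT (Sub V) := by
  obtain ⟨T, hT, hV⟩ := hV
  exact Sub.wellFoundedGT_of_iSup_image hT.toFinset id (fun i _ => h _) fun N hN =>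
    hV N fun t ht => hN t (hT.mem_toFinset.2 ht)

/-! ### Free modules and finite presentation -/

/-- The projection to the cokernel and the zero map agree after composition with `f`, so they are
equal. This turns the epimorphisms in the definition of `Projective` into degreewise surjections,
along which generators lift. -/
theorem component_surjective_of_epi {V W : Mod k C} (f : V ⟶ W) [Epi f] (X : C) :
    Function.Surjective (component f X) := by
  have h : (image f).proj = ObjectProperty.homMk 0 := by
    rw [← cancel_epi f]
    refine hom_ext fun X x => ?_
    rw [component_comp, component_comp]
    exact (Submodule.Quotient.mk_eq_zero _).2 ⟨x, rfl⟩
  intro y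
  have hy : component (image f).proj X y = 0 := by
    rw [h]
    rfl
  exact (Submodule.Quotient.mk_eq_zero _).1 hy

variable (k) in
/-- The direct sum of the representable modules of a finite family of objects. -/
def free {n : ℕ} (s : Fin n → C) : Mod k C :=
  ⟨{ obj := fun X => ModuleCat.of k (∀ i, s i ⟶ X)
     map := fun f => ModuleCat.ofHom
       (LinearMap.pi fun i => (Linear.rightComp k (s i) f).comp (LinearMap.proj i))
     map_id := fun X => by
       refine ModuleCat.hom_ext (LinearMap.ext fun g => funext fun i => ?_)
       exact Category.comp_id (g i)
     map_comp := fun f f' => by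
       refine ModuleCat.hom_ext (LinearMap.ext fun g => funext fun i => ?_)
       exact (Category.assoc (g i) f f').symm },
    ⟨fun {X Y f f'} => by
      refine ModuleCat.hom_ext (LinearMap.ext fun g => funext fun i => ?_)
      exact Preadditive.comp_add _ _ _ (g i) f f'⟩,
    ⟨fun {X Y} f r => by
      refine ModuleCat.hom_ext (LinearMap.ext fun g => funext fun i => ?_)
      exact Linear.comp_smul _ _ _ (g i) r f⟩⟩

section free

variable {n : ℕ} {s : Fin n → C} {V : Mod k C}

theorem free_map_apply {X Y : C} (f : X ⟶ Y) (g : ∀ i, s i ⟶ X) :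
    ((free k s).obj.map f).hom g = fun i => g i ≫ f := rfl

variable (k s) in
/-- The canonical generators of a finite direct sum of representable modules. -/
def freeBasis (i : Fin n) : (free k s).obj.obj (s i) :=
  (Pi.single i (𝟙 (s i)) : ∀ j, s j ⟶ s i)

theorem free_eq_sum {X : C} (g : (free k s).obj.obj X) :
    g = ∑ i, ((free k s).obj.map (show s i ⟶ X from g i)).hom (freeBasis k s i) := by
  have h : ∀ i, (((free k s).obj.map (show s i ⟶ X from g i)).hom (freeBasis k s i) :
      ∀ i, s i ⟶ X) = Pi.single i (show s i ⟶ X from g i) := fun i => by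
    erw [free_map_apply]
    funext j
    obtain rfl | hij := eq_or_ne i j
    · simp [freeBasis]
    · simp [freeBasis, hij.symm]
  exact (Finset.univ_sum_single (fun i => (show s i ⟶ X from g i))).symm.trans
    (Finset.sum_congr rfl fun i _ => (h i).symm)

/-- The homomorphism from a finite direct sum of representable modules that corresponds to a finite
family of elements. -/
def freeHom (x : ∀ i, V.obj.obj (s i)) : free k s ⟶ V :=
  ObjectProperty.homMk
    { app := fun Y => ModuleCat.ofHom
        { toFun := fun g : ∀ i, s i ⟶ Y => ∑ i, component (ofElem (x i)) Y (g i)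
          map_add' := fun f g => by
            rw [← Finset.sum_add_distrib]
            exact Finset.sum_congr rfl fun i _ => map_add (component (ofElem (x i)) Y) (f i) (g i)
          map_smul' := fun r g => by
            rw [Finset.smul_sum]
            exact Finset.sum_congr rfl fun i _ => map_smul (component (ofElem (x i)) Y) r (g i) }
      naturality := fun Y Z f => by
        refine ModuleCat.hom_ext (LinearMap.ext fun (g : ∀ i, s i ⟶ Y) => ?_)
        change ∑ i, component (ofElem (x i)) Z (g i ≫ f) =
          (V.obj.map f).hom (∑ i, component (ofElem (x i)) Y (g i))
        rw [map_sum]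
        exact Finset.sum_congr rfl fun i _ => component_map (ofElem (x i)) f (g i) }

theorem component_freeHom (x : ∀ i, V.obj.obj (s i)) {Y : C}
    (g : (free k s).obj.obj Y) :
    component (freeHom x) Y g = ∑ i, (V.obj.map (show s i ⟶ Y from g i)).hom (x i) := rfl

theorem component_freeHom_freeBasis (x : ∀ i, V.obj.obj (s i)) (i : Fin n) :
    component (freeHom x) (s i) (freeBasis k s i) = x i := by
  have := V.property.1
  rw [component_freeHom, Finset.sum_eq_single i]
  · simp [freeBasis]
  · intro j _ hj
    simp [freeBasis, Pi.single_eq_of_ne hj]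
  · simp

theorem free_hom_ext {f g : free k s ⟶ V}
    (h : ∀ i, component f (s i) (freeBasis k s i) = component g (s i) (freeBasis k s i)) :
    f = g := by
  refine hom_ext fun X x => ?_
  rw [free_eq_sum x, map_sum, map_sum]
  simp only [component_map, h]

theorem isFinitelyGenerated_free : IsFinitelyGenerated (free k s) := by
  refine ⟨Set.range fun i => ⟨s i, freeBasis k s i⟩, Set.finite_range _, fun N hN X => ?_⟩
  refine top_le_iff.1 fun g _ => ?_
  rw [free_eq_sum g]
  exact Submodule.sum_mem _ fun i _ => N.map_mem _ (hN _ ⟨i, rfl⟩)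

instance projective_free : Projective (free k s) where
  factors {E X} f e _ := by
    choose y hy using fun i =>
      component_surjective_of_epi e (s i) (component f (s i) (freeBasis k s i))
    refine ⟨freeHom y, free_hom_ext fun i => ?_⟩
    rw [component_comp, component_freeHom_freeBasis, hy]

theorem Sub.FG.exists_image_eq {N : Sub V} (hN : N.FG) :
    ∃ (n : ℕ) (s : Fin n → C) (f : free k s ⟶ V), image f = N := by
  obtain ⟨T, hT, hTN, h⟩ := hN
  obtain ⟨n, t, -, rfl⟩ := hT.fin_param
  refine ⟨n, fun i => (t i).1, freeHom fun i => (t i).2, le_antisymm ?_ (h _ ?_)⟩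
  · rintro X _ ⟨g, rfl⟩
    rw [component_freeHom]
    exact Submodule.sum_mem _ fun i _ => N.map_mem _ (hTN _ ⟨i, rfl⟩)
  · rintro _ ⟨i, rfl⟩
    exact ⟨freeBasis k _ i, component_freeHom_freeBasis _ i⟩

end free

theorem isFinitelyPresented_of_wellFoundedGT (V : Mod k C) [WellFoundedGT (Sub V)]
    (h : ∀ X : C, WellFoundedGT (Sub (representable k X))) : IsFinitelyPresented V := by
  obtain ⟨n, s, ε, hε⟩ := (Sub.FG_of_wellFoundedGT (⊤ : Sub V)).exists_image_eq
  have := (isFinitelyGenerated_free (k := k) (s := s)).wellFoundedGT h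
  -- The preimage of `⊥` is the kernel of `ε`, finitely generated because `free k s` is Noetherian.
  obtain ⟨m, t, d, hd⟩ := (Sub.FG_of_wellFoundedGT (Sub.comap ε ⊥)).exists_image_eq
  refine ⟨free k t, free k s, d, ε, inferInstance, inferInstance, isFinitelyGenerated_free,
    isFinitelyGenerated_free, fun X => ?_, fun X y => ?_⟩
  · exact LinearMap.range_eq_top.1 (congr_arg (fun N => N.carrier X) hε)
  · have hy : y ∈ (image d).carrier X ↔ y ∈ (Sub.comap ε ⊥).carrier X := by rw [hd]
    exact hy.symm

/-! ### Induction on s and the main theorem -/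

/-- If the cokernel of `M(s) ⟶ S M(s)` is generated in degrees `≤ s - 1` for every `s`, then the
modules `M(s)` and these cokernels are Noetherian. Injectivity of `M(s) ⟶ S M(s)` and finite
presentation of `S M(s)` are not needed for this. -/
theorem wellFoundedGT_representable [IsNoetherianRing k] (obj : ℕ ≃ C)
    (hfin : ∀ r s : ℕ, Module.Finite k (obj r ⟶ obj s)) {ι : C ⥤ C} [ι.Additive] [ι.Linear k]
    (hι : ∀ s : ℕ, ι.obj (obj s) = obj (s + 1)) (μ : 𝟭 (Mod k C) ⟶ pullback k ι)
    (hμ : ∀ s : ℕ, IsGeneratedInDegreesLE obj (coker (μ.app (representable k (obj s))))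
      ((s : ℤ) - 1)) (s : ℕ) :
    WellFoundedGT (Sub (coker (μ.app (representable k (obj s))))) ∧
      WellFoundedGT (Sub (representable k (obj s))) := by
  induction s using Nat.strong_induction_on with
  | _ s ih =>
    have h₁ : WellFoundedGT (Sub (coker (μ.app (representable k (obj s))))) := by
      -- Generators in degrees r ≤ s - 1 involve only M(r) with r < s. For s = 0 there are none, so
      -- no separate base case is needed.
      refine wellFoundedGT_of_isGeneratedInDegreesLE obj (hμ s) (fun r => ?_)
        fun r hr => (ih r (by omega)).2
      have h : Module.Finite k ((representable k (obj s)).obj.obj (ι.obj (obj r))) := by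
        rw [hι]
        exact hfin s (r + 1)
      exact Module.Finite.of_surjective
        (M := ((pullback k ι).obj (representable k (obj s))).obj.obj (obj r)) (hM := h)
        (component (image (μ.app (representable k (obj s)))).proj (obj r))
        (Submodule.mkQ_surjective _)
    have h₂ : IsNoetherian k ((representable k (obj s)).obj.obj (obj 0)) := by
      have := hfin s 0
      exact isNoetherian_of_isNoetherianRing_of_finite k (obj s ⟶ obj 0)
    exact ⟨h₁, Sub.wellFoundedGT_of_coker_natTrans obj hι μ⟩

end LinCat

theorem theorem1p1 (k : Type u) [CommRing k] [IsNoetherianRing k]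
    (C : Type w) [Category.{v} C] [Preadditive C] [Linear k C]
    -- the objects of `C` are parameterized by the nonnegative integers
    (obj : ℕ ≃ C)
    -- `C` is locally finite
    (hfin : ∀ r s : ℕ, Module.Finite k (obj r ⟶ obj s))
    -- `C` is directed
    (hdir : ∀ r s : ℕ, s < r → ∀ f : obj r ⟶ obj s, f = 0)
    (S : LinCat.Mod k C ⥤ LinCat.Mod k C) (hS : LinCat.IsGenericShiftFunctor obj S) :
    (∀ V : LinCat.Mod k C, LinCat.IsFinitelyGenerated V → LinCat.IsNoeth V) ↔
      ∀ s : ℕ, LinCat.IsFinitelyPresented (S.obj (LinCat.representable k (obj s))) := by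
  obtain ⟨⟨ι, _, _, _, hι, rfl⟩, μ, hμ⟩ := hS
  have hM := LinCat.wellFoundedGT_representable obj hfin hι μ fun s => (hμ s).2
  have hrep : ∀ X : C, WellFoundedGT (LinCat.Sub (LinCat.representable k X)) := fun X => by
    obtain ⟨s, rfl⟩ := obj.surjective X
    exact (hM s).2
  refine ⟨fun _ s => ?_, fun _ V hV N => ?_⟩
  · obtain ⟨_, h⟩ := hM s
    have : WellFoundedGT (LinCat.Sub ((𝟭 (LinCat.Mod k C)).obj (LinCat.representable k (obj s)))) := h
    -- SM(s) is an extension of the cokernel by the image of M(s), both Noetherian.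
    have := LinCat.Sub.wellFoundedGT_of_image_of_coker (μ.app (LinCat.representable k (obj s)))
    exact LinCat.isFinitelyPresented_of_wellFoundedGT _ hrep
  · have := hV.wellFoundedGT hrep
    exact N.FG_of_wellFoundedGT
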